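/- Let $d\ge 1$, let $\mathcal Q=[0,1]^d\subset\mathbb R^d$ be the closed unit cube, and let $|\cdot|$ be the Euclidean norm. There is a constant $c_d>0$, depending only on $d$, such that for every continuous function $f:\mathcal Q\to\mathbb R$ with zero mean, $\int_{\mathcal Q}f\,dx=0$, $$W_1(f^+,f^-)\;\mathcal H^{d-1}(Z(f))\;\left(\frac{\|f\|_\infty}{\|f\|_1}\right)^{2-1/d}\;\ge\; c_d\,\|f\|_1 .$$ Here $f^+=\max\{f,0\}$, $f^-=\max\{-f,0\}$, $Z(f)=\{x\in\mathcal Q: f(x)=0\}$, $\mathcal H^{d-1}$ is $(d-1)$-dimensional Hausdorff measure (possibly $+\infty$), $\|f\|_p$ is the norm of $L^p(\mathcal Q)$ with respect to Lebesgue measure, and $$W_1(f^+,f^-)=\inf_\rho\int_{\mathcal Q\times\mathcal Q}|x-y|\,d\rho(x,y),$$ the infimum being over all (positive) measures $\rho$ on $\mathcal Q\times\mathcal Q$ with marginals $f^+\,dx$ and $f^-\,dx$. (For $f\equiv0$ the quotient is to be read as $0$ and the inequality is trivial.) -/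

import Mathlib

open MeasureTheory
open scoped ENNReal NNReal

/-- The closed unit cube `[0,1]^d` in Euclidean space `ℝ^d`. -/
def unitCube (d : ℕ) : Set (EuclideanSpace ℝ (Fin d)) :=
  {x | ∀ i, x i ∈ Set.Icc (0 : ℝ) 1}

/-- Lebesgue measure on the unit cube. -/
noncomputable def cubeVolume (d : ℕ) : Measure (EuclideanSpace ℝ (Fin d)) :=
  (volume : Measure (EuclideanSpace ℝ (Fin d))).restrict (unitCube d)

/-- A transport plan (coupling) from `μ` to `ν`: a measure on the product with marginals `μ` and
`ν`. It can only exist when `μ` and `ν` have the same total mass. -/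
def IsCoupling {X : Type*} [MeasurableSpace X] (ρ : Measure (X × X)) (μ ν : Measure X) : Prop :=
  ρ.map Prod.fst = μ ∧ ρ.map Prod.snd = ν

/-- The Vaserstein (earth mover's) distance `W₁` of two measures of equal total mass: the infimum
of the transport cost `∫ |x - y| dρ(x, y)` over all transport plans `ρ` from `μ` to `ν`. -/
noncomputable def vasersteinDist {X : Type*} [MeasurableSpace X] [PseudoEMetricSpace X]
    (μ ν : Measure X) : ℝ≥0∞ :=
  ⨅ (ρ : Measure (X × X)) (_ : IsCoupling ρ μ ν), ∫⁻ p, edist p.1 p.2 ∂ρ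

/-- The measure on the unit cube with density `f⁺ = max {f, 0}`. -/
noncomputable def posPartMeasure {d : ℕ} (f : EuclideanSpace ℝ (Fin d) → ℝ) :
    Measure (EuclideanSpace ℝ (Fin d)) :=
  (cubeVolume d).withDensity fun x => ENNReal.ofReal (max (f x) 0)

/-- The measure on the unit cube with density `f⁻ = max {-f, 0}`. -/
noncomputable def negPartMeasure {d : ℕ} (f : EuclideanSpace ℝ (Fin d) → ℝ) :
    Measure (EuclideanSpace ℝ (Fin d)) :=
  (cubeVolume d).withDensity fun x => ENNReal.ofReal (max (-f x) 0)

/-- The nodal set `Z(f)`: the zeros of `f` in the unit cube. -/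
def nodalSet {d : ℕ} (f : EuclideanSpace ℝ (Fin d) → ℝ) : Set (EuclideanSpace ℝ (Fin d)) :=
  {x ∈ unitCube d | f x = 0}

/-! The heart is a relative isoperimetric inequality in boxes (`volume_pos_mul_volume_nonpos_le`).
Moving from a positive point to a nonpositive one by changing one coordinate at a time, some
axis-parallel step meets the nodal set, so pairs of opposite sign are controlled by the coordinate
projections of `Z`. Hence in a box of sides at most `s` the smaller of the masses of `f⁺` and `f⁻`
is at most a constant times `‖f‖_∞ s H(Z ∩ box)` (`min_measure_box_le`).

Cut the cube by a grid of mesh `1/N`. A transport plan either keeps mass within its cell, which the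
box bound limits, or moves it across the grid; averaged over shifts of the grid, the crossing mass
is at most `d N` times the cost. So the total mass `p` of `f⁺` is bounded by a term of order `‖f‖_∞
H(Z)/N` plus one of order `N W₁`, and choosing `N` gives `p² ≲ ‖f‖_∞ H(Z) W₁`
(`sq_posPartMeasure_le`). This is the theorem with exponent `1` on `‖f‖_∞/‖f‖₁`; as that ratio is at
least `1`, the exponent `2 - 1/d ≥ 1` only weakens it. -/

/-! ### Relative isoperimetry in boxes -/

/-- The point whose coordinates below `j` are those of `p.2`, the others being those of `p.1`. -/
def mixCoords {d : ℕ} (j : ℕ) (p : (Fin d → ℝ) × (Fin d → ℝ)) : Fin d → ℝ :=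
  fun i => if i.val < j then p.2 i else p.1 i

/-- The map acts coordinatewise on pairs, swapping the two entries for `i < j` and fixing them
otherwise. -/
lemma measurePreserving_mixCoords {d : ℕ} (j : ℕ) :
    MeasurePreserving (fun p : (Fin d → ℝ) × (Fin d → ℝ) => (mixCoords j p, mixCoords j p.swap))
      (volume.prod volume) (volume.prod volume) := by
  have h1 := volume_measurePreserving_arrowProdEquivProdArrow ℝ ℝ (Fin d)
  have h2 : MeasurePreserving
      (fun (q : Fin d → ℝ × ℝ) i => (if i.val < j then (Prod.swap : ℝ × ℝ → ℝ × ℝ) else id) (q i))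
      volume volume := by
    refine volume_preserving_pi (f := fun i : Fin d =>
      if i.val < j then (Prod.swap : ℝ × ℝ → ℝ × ℝ) else id) fun i => ?_
    split_ifs
    · exact Measure.measurePreserving_swap
    · exact MeasurePreserving.id _
  have h := (h1.comp h2).comp (MeasurePreserving.symm _ h1)
  have e : (fun p : (Fin d → ℝ) × (Fin d → ℝ) => (mixCoords j p, mixCoords j p.swap)) =
      (MeasurableEquiv.arrowProdEquivProdArrow ℝ ℝ (Fin d) ∘ fun q i =>
        (if i.val < j then (Prod.swap : ℝ × ℝ → ℝ × ℝ) else id) (q i)) ∘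
      (MeasurableEquiv.arrowProdEquivProdArrow ℝ ℝ (Fin d)).symm := by
    funext p
    refine Prod.ext ?_ ?_ <;> funext i <;>
      simp only [mixCoords, Function.comp, MeasurableEquiv.arrowProdEquivProdArrow,
        Equiv.arrowProdEquivProdArrow] <;> by_cases hi : i.val < j <;> simp [hi]
  rw [e]
  exact h

/-- Along the chain `mixCoords 0 = x`, ..., `mixCoords (n + 1) = y`, the sign of `F` changes at some
step. That step varies only coordinate `j`, so the intermediate value theorem gives a zero on its
segment. -/
lemma exists_zero_of_mixCoords {n : ℕ} {I : Fin (n + 1) → Set ℝ} (hI : ∀ i, (I i).OrdConnected)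
    {F : (Fin (n + 1) → ℝ) → ℝ} (hF : ContinuousOn F (Set.univ.pi I))
    {x y : Fin (n + 1) → ℝ} (hx : x ∈ Set.univ.pi I) (hy : y ∈ Set.univ.pi I)
    (hFx : 0 < F x) (hFy : F y ≤ 0) :
    ∃ j : Fin (n + 1), ∃ z ∈ Set.univ.pi I, F z = 0 ∧
      j.removeNth z = j.removeNth (mixCoords j.val (x, y)) := by
  have hmem : ∀ j, mixCoords j (x, y) ∈ Set.univ.pi I := fun j i _ => by
    by_cases h : i.val < j
    · simpa [mixCoords, h] using hy i trivial
    · simpa [mixCoords, h] using hx i trivial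
  obtain ⟨j, hj, hj0, hj1⟩ : ∃ j < n + 1, 0 < F (mixCoords j (x, y)) ∧
      F (mixCoords (j + 1) (x, y)) ≤ 0 := by
    by_contra! hcon
    have : ∀ j ≤ n + 1, 0 < F (mixCoords j (x, y)) := by
      intro j
      induction j with
      | zero =>
        intro _
        have e : mixCoords 0 (x, y) = x := by funext i; simp [mixCoords]
        rwa [e]
      | succ k ih => intro hk; exact hcon k (by omega) (ih (by omega))
    have h := this (n + 1) le_rfl
    have e : mixCoords (n + 1) (x, y) = y := by
      funext i; simp [mixCoords, i.isLt]
    rw [e] at h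
    linarith
  refine ⟨⟨j, hj⟩, ?_⟩
  set z := mixCoords j (x, y) with hz
  set w := mixCoords (j + 1) (x, y) with hw
  have hupd : w = Function.update z ⟨j, hj⟩ (w ⟨j, hj⟩) := by
    funext i
    by_cases h : i = ⟨j, hj⟩
    · subst h; simp
    · rw [Function.update_of_ne h]
      have h' : i.val ≠ j := fun e => h (Fin.ext e)
      have : i.val < j + 1 ↔ i.val < j := by omega
      simp [hz, hw, mixCoords, this]
  have hupd' : z = Function.update z ⟨j, hj⟩ (z ⟨j, hj⟩) := by simp
  have hmaps : ∀ t ∈ I ⟨j, hj⟩, Function.update z ⟨j, hj⟩ t ∈ Set.univ.pi I := by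
    intro t ht i _
    by_cases h : i = ⟨j, hj⟩
    · subst h; simpa using ht
    · rw [Function.update_of_ne h]; exact hmem j i trivial
  have hpc : IsPreconnected (I ⟨j, hj⟩) := (hI _).isPreconnected
  have hcont : ContinuousOn (fun t => F (Function.update z ⟨j, hj⟩ t)) (I ⟨j, hj⟩) :=
    hF.comp (Continuous.continuousOn (by fun_prop)) hmaps
  have hzero : (0 : ℝ) ∈ Set.Icc (F (Function.update z ⟨j, hj⟩ (w ⟨j, hj⟩)))
      (F (Function.update z ⟨j, hj⟩ (z ⟨j, hj⟩))) := by
    rw [← hupd, ← hupd']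
    exact ⟨hj1, hj0.le⟩
  obtain ⟨t, ht, ht0⟩ := hpc.intermediate_value (hmem (j + 1) ⟨j, hj⟩ trivial)
    (hmem j ⟨j, hj⟩ trivial) hcont hzero
  exact ⟨_, hmaps t ht, ht0, by funext i; simp [Fin.removeNth]⟩

lemma volume_cylinder_le {n : ℕ} (I : Fin (n + 1) → Set ℝ) (j : Fin (n + 1))
    (E : Set (Fin n → ℝ)) :
    volume (Set.univ.pi I ∩ {z | j.removeNth z ∈ E}) ≤ volume (I j) * volume E := by
  have h := volume_preserving_piFinSuccAbove (fun _ : Fin (n + 1) => ℝ) j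
  calc volume (Set.univ.pi I ∩ {z | j.removeNth z ∈ E})
      ≤ volume (MeasurableEquiv.piFinSuccAbove (fun _ : Fin (n + 1) => ℝ) j ⁻¹' (I j ×ˢ E)) :=
        measure_mono fun z hz => ⟨hz.1 j trivial, hz.2⟩
    _ = volume (I j) * volume E := by
        rw [h.measure_preimage_equiv]; exact Measure.prod_prod _ _

lemma volume_pos_mul_volume_nonpos_le {n : ℕ} {I : Fin (n + 1) → Set ℝ}
    (hI : ∀ i, (I i).OrdConnected) {s : ℝ≥0∞} (hs : ∀ i, volume (I i) ≤ s)
    {F : (Fin (n + 1) → ℝ) → ℝ} (hF : ContinuousOn F (Set.univ.pi I)) :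
    volume (Set.univ.pi I ∩ {x | 0 < F x}) * volume (Set.univ.pi I ∩ {x | F x ≤ 0}) ≤
      ((n : ℝ≥0∞) + 1) * s * volume (Set.univ.pi I) *
        Measure.hausdorffMeasure (n : ℝ) (Set.univ.pi I ∩ {x | F x = 0}) := by
  set Q := Set.univ.pi I with hQ
  set Z := Q ∩ {x | F x = 0} with hZ
  have hQm : MeasurableSet Q := MeasurableSet.univ_pi fun i => (hI i).measurableSet
  -- Measurable hulls of the projections of `Z` avoid having to prove the projections measurable.
  let E : Fin (n + 1) → Set (Fin n → ℝ) := fun j =>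
    toMeasurable volume ((fun z : Fin (n + 1) → ℝ => j.removeNth z) '' Z)
  have hE : ∀ j, volume (E j) ≤ Measure.hausdorffMeasure (n : ℝ) Z := by
    intro j
    rw [measure_toMeasurable]
    have hl : LipschitzWith 1 (fun z : Fin (n + 1) → ℝ => j.removeNth z) := by
      refine LipschitzWith.of_edist_le fun x y => ?_
      rw [edist_pi_le_iff]
      exact fun i => edist_le_pi_edist x y _
    have h := hl.hausdorffMeasure_image_le (d := (n : ℝ)) (by positivity) Z
    rw [← hausdorffMeasure_pi_real]
    simpa using h
  have hrm : ∀ j : Fin (n + 1), Measurable (fun z : Fin (n + 1) → ℝ => j.removeNth z) :=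
    fun j => measurable_pi_iff.2 fun i => measurable_pi_apply _
  let T : Fin (n + 1) → Set (Fin (n + 1) → ℝ) := fun j => Q ∩ {z | j.removeNth z ∈ E j}
  have hT : ∀ j, MeasurableSet (T j) := fun j =>
    hQm.inter ((hrm j) (measurableSet_toMeasurable _ _))
  rw [← Measure.prod_prod (μ := volume) (ν := volume)]
  -- After the coordinate swap, the first point of a pair lies in the cylinder over a projection of
  -- `Z`, while the second is free in `Q`.
  calc (volume.prod volume) ((Q ∩ {x | 0 < F x}) ×ˢ (Q ∩ {x | F x ≤ 0}))
      ≤ (volume.prod volume) (⋃ j : Fin (n + 1),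
          (fun p : (Fin (n + 1) → ℝ) × (Fin (n + 1) → ℝ) =>
            (mixCoords j.val p, mixCoords j.val p.swap)) ⁻¹' (T j ×ˢ Q)) := by
        refine measure_mono ?_
        rintro ⟨x, y⟩ ⟨⟨hx, hFx⟩, hy, hFy⟩
        obtain ⟨j, z, hz, hz0, hzj⟩ := exists_zero_of_mixCoords hI hF hx hy hFx hFy
        refine Set.mem_iUnion.2 ⟨j, ⟨⟨fun i _ => ?_, ?_⟩, fun i _ => ?_⟩⟩
        · by_cases h : i.val < j.val
          · simpa [mixCoords, h] using hy i trivial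
          · simpa [mixCoords, h] using hx i trivial
        · exact subset_toMeasurable _ _ ⟨z, ⟨hz, hz0⟩, hzj⟩
        · by_cases h : i.val < j.val
          · simpa [mixCoords, h] using hx i trivial
          · simpa [mixCoords, h] using hy i trivial
    _ ≤ ∑ j : Fin (n + 1), (volume.prod volume)
          ((fun p : (Fin (n + 1) → ℝ) × (Fin (n + 1) → ℝ) =>
            (mixCoords j.val p, mixCoords j.val p.swap)) ⁻¹' (T j ×ˢ Q)) :=
        measure_iUnion_fintype_le _ _
    _ = ∑ j : Fin (n + 1), volume (T j) * volume Q := by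
        refine Finset.sum_congr rfl fun j _ => ?_
        rw [(measurePreserving_mixCoords j.val).measure_preimage
          ((hT j).prod hQm).nullMeasurableSet, Measure.prod_prod]
    _ ≤ ∑ _j : Fin (n + 1), (s * Measure.hausdorffMeasure (n : ℝ) Z) * volume Q := by
        refine Finset.sum_le_sum fun j _ => ?_
        gcongr
        exact (volume_cylinder_le I j (E j)).trans (mul_le_mul' (hs j) (hE j))
    _ = ((n : ℝ≥0∞) + 1) * s * volume Q * Measure.hausdorffMeasure (n : ℝ) Z := by
        simp only [Finset.sum_const, Finset.card_univ, Fintype.card_fin, nsmul_eq_mul]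
        push_cast
        ring

/-! ### Mass leaving the cells of a partition -/

section Transport

variable {X : Type*} [MeasurableSpace X] {μ ν : Measure X} {ρ : Measure (X × X)}

/-- If `μ S` exceeds `ν S`, the excess cannot be received inside `S`, so the plan carries it out of
`S`. -/
lemma IsCoupling.measure_le_min_add (h : IsCoupling ρ μ ν) {S : Set X} (hS : MeasurableSet S) :
    μ S ≤ min (μ S) (ν S) + ρ {p | p.1 ∈ S ∧ p.2 ∉ S} := by
  rcases le_total (μ S) (ν S) with hle | hle
  · rw [min_eq_left hle]; exact le_self_add
  · rw [min_eq_right hle]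
    conv_lhs => rw [← h.1]
    rw [← h.2, Measure.map_apply measurable_fst hS, Measure.map_apply measurable_snd hS]
    refine (measure_mono fun p hp => ?_).trans (measure_union_le _ _)
    by_cases hp2 : p.2 ∈ S
    · exact Or.inl hp2
    · exact Or.inr ⟨hp, hp2⟩

lemma IsCoupling.measure_univ_le_of_partition (h : IsCoupling ρ μ ν) {K : Type*} [Countable K]
    {c : X → K} (hc : ∀ k, MeasurableSet (c ⁻¹' {k})) {κ : Measure X}
    (hκ : ∀ k, min (μ (c ⁻¹' {k})) (ν (c ⁻¹' {k})) ≤ κ (c ⁻¹' {k})) :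
    μ Set.univ ≤ κ Set.univ + ρ {p | c p.1 ≠ c p.2} := by
  have hU : (⋃ k, c ⁻¹' {k}) = Set.univ := by
    ext x; simp
  have hd : Pairwise (Function.onFun Disjoint fun k => c ⁻¹' {k}) := fun i j hij =>
    Set.disjoint_left.2 fun x hi hj => hij (hi.symm.trans hj)
  have hS : ∀ k, MeasurableSet {p : X × X | p.1 ∈ c ⁻¹' {k} ∧ p.2 ∉ c ⁻¹' {k}} := fun k =>
    (measurable_fst (hc k)).inter (measurable_snd (hc k).compl)
  have hd' : Pairwise (Function.onFun Disjoint
      fun k => {p : X × X | p.1 ∈ c ⁻¹' {k} ∧ p.2 ∉ c ⁻¹' {k}}) := fun i j hij =>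
    Set.disjoint_left.2 fun x hi hj => hij (hi.1.symm.trans hj.1)
  rw [← hU, measure_iUnion hd hc, measure_iUnion hd hc]
  calc ∑' k, μ (c ⁻¹' {k})
      ≤ ∑' k, (κ (c ⁻¹' {k}) + ρ {p | p.1 ∈ c ⁻¹' {k} ∧ p.2 ∉ c ⁻¹' {k}}) :=
        ENNReal.tsum_le_tsum fun k =>
          (h.measure_le_min_add (hc k)).trans (add_le_add_left (hκ k) _)
    _ = ∑' k, κ (c ⁻¹' {k}) + ρ (⋃ k, {p | p.1 ∈ c ⁻¹' {k} ∧ p.2 ∉ c ⁻¹' {k}}) := by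
        rw [ENNReal.tsum_add, measure_iUnion hd' hS]
    _ ≤ _ := by
        refine add_le_add_right (measure_mono fun p hp => ?_) _
        obtain ⟨k, hk1, hk2⟩ := Set.mem_iUnion.1 hp
        rw [Set.mem_ofPred_eq, show c p.1 = k from hk1]
        exact fun e => hk2 e.symm

lemma IsCoupling.isFiniteMeasure [IsFiniteMeasure μ] (h : IsCoupling ρ μ ν) :
    IsFiniteMeasure ρ := by
  refine ⟨?_⟩
  have : ρ Set.univ = μ Set.univ := by
    rw [← h.1, Measure.map_apply measurable_fst MeasurableSet.univ, Set.preimage_univ]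
  rw [this]
  exact measure_lt_top _ _

end Transport

/-! ### Randomly shifted grids -/

section Grid

lemma volume_floor_add_ne_le (a b : ℝ) :
    volume ({τ : ℝ | ⌊a + τ⌋ ≠ ⌊b + τ⌋} ∩ Set.Ico 0 1) ≤ ENNReal.ofReal |a - b| := by
  wlog hab : a ≤ b generalizing a b
  · have := this b a (le_of_not_ge hab)
    rw [abs_sub_comm]
    simpa only [ne_comm] using this
  have hsub : {τ : ℝ | ⌊a + τ⌋ ≠ ⌊b + τ⌋} ∩ Set.Ico 0 1 ⊆
      ⋃ n : ℤ, (Set.Ico (n - b) (n - a) ∩ Set.Ico (0 : ℝ) 1) := by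
    rintro τ ⟨hτ, hτ'⟩
    have hlt : ⌊a + τ⌋ < ⌊b + τ⌋ := lt_of_le_of_ne (Int.floor_le_floor (by linarith)) hτ
    have h1 := Int.floor_lt.1 hlt
    have h2 := Int.floor_le (b + τ)
    exact Set.mem_iUnion.2 ⟨⌊b + τ⌋, ⟨by linarith, by linarith⟩, hτ'⟩
  -- Translating the `n`-th piece by `-n` makes the pieces disjoint parts of one interval of length
  -- `|a - b|`.
  have hshift : ∀ n : ℤ, volume (Set.Ico ((n : ℝ) - b) (n - a) ∩ Set.Ico (0 : ℝ) 1) =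
      volume (Set.Ico (-b) (-a) ∩ Set.Ico (-(n : ℝ)) (-n + 1)) := by
    intro n
    rw [Set.Ico_inter_Ico, Set.Ico_inter_Ico, Real.volume_Ico, Real.volume_Ico]
    congr 1
    have e1 : min (-a) (-(n : ℝ) + 1) = min ((n : ℝ) - a) 1 - n := by
      rw [← min_sub_sub_right]; ring_nf
    have e2 : max (-b) (-(n : ℝ)) = max ((n : ℝ) - b) 0 - n := by
      rw [← max_sub_sub_right]; ring_nf
    rw [show (-a ⊓ (-(n : ℝ) + 1)) = _ from e1, show (-b ⊔ -(n : ℝ)) = _ from e2]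
    ring
  have hdisj : Pairwise (Function.onFun Disjoint
      fun n : ℤ => Set.Ico (-b) (-a) ∩ Set.Ico (-(n : ℝ)) (-n + 1)) := by
    intro m n hmn
    refine Set.disjoint_left.2 ?_
    rintro x ⟨-, h1, h2⟩ ⟨-, h3, h4⟩
    apply hmn
    have h5 : (m : ℝ) < n + 1 := by linarith
    have h6 : (n : ℝ) < m + 1 := by linarith
    norm_cast at h5 h6
    omega
  calc _ ≤ _ := measure_mono hsub
    _ ≤ ∑' n : ℤ, volume (Set.Ico ((n : ℝ) - b) (n - a) ∩ Set.Ico (0 : ℝ) 1) :=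
        measure_iUnion_le _
    _ = volume (⋃ n : ℤ, Set.Ico (-b) (-a) ∩ Set.Ico (-(n : ℝ)) (-n + 1)) := by
        rw [measure_iUnion hdisj fun n => measurableSet_Ico.inter measurableSet_Ico]
        exact tsum_congr hshift
    _ ≤ volume (Set.Ico (-b) (-a)) :=
        measure_mono (Set.iUnion_subset fun n => Set.inter_subset_left)
    _ = ENNReal.ofReal |a - b| := by
        rw [Real.volume_Ico, abs_sub_comm, abs_of_nonneg (by linarith)]
        ring_nf

variable {d : ℕ}

/-- The index of the cell containing `x` in the cubic grid of mesh `N⁻¹` shifted by `τ / N` in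
every coordinate. -/
noncomputable def gridIndex (N τ : ℝ) (x : EuclideanSpace ℝ (Fin d)) : Fin d → ℤ :=
  fun i => ⌊N * x i + τ⌋

lemma measurableSet_gridIndex_preimage (N τ : ℝ) (k : Fin d → ℤ) :
    MeasurableSet (gridIndex N τ ⁻¹' {k}) := by
  have : Measurable (gridIndex (d := d) N τ) :=
    measurable_pi_iff.2 fun i => Int.measurable_floor.comp (by fun_prop)
  exact this (measurableSet_singleton k)

/-- By Tonelli it suffices to fix a pair of points: coordinate `i` separates them for a set of
shifts of measure at most `N |x i - y i|`. -/
lemma lintegral_measure_gridIndex_ne_le {N : ℝ} (hN : 0 < N)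
    (ρ : Measure (EuclideanSpace ℝ (Fin d) × EuclideanSpace ℝ (Fin d))) [SFinite ρ] :
    ∫⁻ τ in Set.Ico (0 : ℝ) 1, ρ {p | gridIndex N τ p.1 ≠ gridIndex N τ p.2} ≤
      d * ENNReal.ofReal N * ∫⁻ p, edist p.1 p.2 ∂ρ := by
  let S : Set (ℝ × (EuclideanSpace ℝ (Fin d) × EuclideanSpace ℝ (Fin d))) :=
    {q | gridIndex N q.1 q.2.1 ≠ gridIndex N q.1 q.2.2}
  have hS : MeasurableSet S := by
    refine (measurableSet_eq_fun ?_ ?_).compl <;>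
    exact measurable_pi_iff.2 fun i => Int.measurable_floor.comp (by fun_prop)
  have h1 : ∫⁻ τ in Set.Ico (0 : ℝ) 1, ρ {p | gridIndex N τ p.1 ≠ gridIndex N τ p.2} =
      ((volume.restrict (Set.Ico (0 : ℝ) 1)).prod ρ) S := (Measure.prod_apply hS).symm
  rw [h1, Measure.prod_apply_symm hS, ← lintegral_const_mul' _ _ (by finiteness)]
  refine lintegral_mono fun p => ?_
  rw [Measure.restrict_apply (hS.preimage measurable_prodMk_right)]
  calc volume ((fun τ => (τ, p)) ⁻¹' S ∩ Set.Ico (0 : ℝ) 1)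
      ≤ volume (⋃ i : Fin d, {τ : ℝ | ⌊N * p.1 i + τ⌋ ≠ ⌊N * p.2 i + τ⌋} ∩ Set.Ico 0 1) := by
        refine measure_mono fun τ hτ => ?_
        obtain ⟨i, hi⟩ := Function.ne_iff.1 hτ.1
        exact Set.mem_iUnion.2 ⟨i, hi, hτ.2⟩
    _ ≤ ∑ i : Fin d, volume ({τ : ℝ | ⌊N * p.1 i + τ⌋ ≠ ⌊N * p.2 i + τ⌋} ∩ Set.Ico 0 1) :=
        measure_iUnion_fintype_le _ _
    _ ≤ ∑ _i : Fin d, ENNReal.ofReal N * edist p.1 p.2 := by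
        refine Finset.sum_le_sum fun i _ => (volume_floor_add_ne_le _ _).trans ?_
        rw [← mul_sub, abs_mul, abs_of_pos hN, ENNReal.ofReal_mul hN.le, ← Real.dist_eq,
          ← edist_dist]
        gcongr
        exact (edist_le_pi_edist (WithLp.ofLp p.1) (WithLp.ofLp p.2) i).trans
          (by simpa using PiLp.lipschitzWith_ofLp 2 (fun _ : Fin d => ℝ) p.1 p.2)
    _ = d * ENNReal.ofReal N * edist p.1 p.2 := by
        simp [mul_assoc]

lemma IsCoupling.measure_univ_le_of_grid {μ ν κ : Measure (EuclideanSpace ℝ (Fin d))}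
    [IsFiniteMeasure μ]
    {ρ : Measure (EuclideanSpace ℝ (Fin d) × EuclideanSpace ℝ (Fin d))} (h : IsCoupling ρ μ ν)
    {N : ℝ} (hN : 0 < N)
    (hκ : ∀ τ k, min (μ (gridIndex N τ ⁻¹' {k})) (ν (gridIndex N τ ⁻¹' {k})) ≤
      κ (gridIndex N τ ⁻¹' {k})) :
    μ Set.univ ≤ κ Set.univ + d * ENNReal.ofReal N * ∫⁻ p, edist p.1 p.2 ∂ρ := by
  have := h.isFiniteMeasure
  calc μ Set.univ = ∫⁻ _τ in Set.Ico (0 : ℝ) 1, μ Set.univ := by simp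
    _ ≤ ∫⁻ τ in Set.Ico (0 : ℝ) 1,
          (κ Set.univ + ρ {p | gridIndex N τ p.1 ≠ gridIndex N τ p.2}) :=
        lintegral_mono fun τ => h.measure_univ_le_of_partition
          (measurableSet_gridIndex_preimage N τ) (hκ τ)
    _ = κ Set.univ + ∫⁻ τ in Set.Ico (0 : ℝ) 1,
          ρ {p | gridIndex N τ p.1 ≠ gridIndex N τ p.2} := by
        rw [lintegral_add_left measurable_const]; simp
    _ ≤ _ := by gcongr; exact lintegral_measure_gridIndex_ne_le hN ρ

lemma ordConnected_floor_preimage {N : ℝ} (hN : 0 < N) (τ : ℝ) (k : ℤ) :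
    {t : ℝ | ⌊N * t + τ⌋ = k}.OrdConnected := by
  have hm : Monotone fun t : ℝ => ⌊N * t + τ⌋ := fun a b hab =>
    Int.floor_le_floor (by nlinarith)
  exact Set.ordConnected_singleton.preimage_mono hm

lemma volume_floor_preimage_le {N : ℝ} (hN : 0 < N) (τ : ℝ) (k : ℤ) :
    volume {t : ℝ | ⌊N * t + τ⌋ = k} ≤ ENNReal.ofReal N⁻¹ := by
  calc volume {t : ℝ | ⌊N * t + τ⌋ = k} ≤ volume (Set.Icc ((k - τ) / N) ((k + 1 - τ) / N)) := by
        refine measure_mono fun t ht => ?_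
        obtain ⟨h1, h2⟩ := Int.floor_eq_iff.1 ht
        constructor
        · rw [div_le_iff₀ hN]; linarith
        · rw [le_div_iff₀ hN]; linarith
    _ = ENNReal.ofReal N⁻¹ := by
        rw [Real.volume_Icc]; congr 1; field_simp; ring

end Grid

/-! ### Box estimates for the measures `f⁺ dx` and `f⁻ dx` -/

lemma volume_box_pos_mul_volume_box_nonpos_le {n : ℕ} {I : Fin (n + 1) → Set ℝ}
    (hI : ∀ i, (I i).OrdConnected) {s : ℝ≥0∞} (hs : ∀ i, volume (I i) ≤ s)
    {f : EuclideanSpace ℝ (Fin (n + 1)) → ℝ} (hf : ContinuousOn f {x | ∀ i, x i ∈ I i}) :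
    volume ({x | ∀ i, x i ∈ I i} ∩ {x | 0 < f x}) *
        volume ({x | ∀ i, x i ∈ I i} ∩ {x | f x ≤ 0}) ≤
      ((n : ℝ≥0∞) + 1) * s * volume {x : EuclideanSpace ℝ (Fin (n + 1)) | ∀ i, x i ∈ I i} *
        Measure.hausdorffMeasure (n : ℝ) ({x | ∀ i, x i ∈ I i} ∩ {x | f x = 0}) := by
  have hvol : ∀ S : Set (EuclideanSpace ℝ (Fin (n + 1))),
      volume S = volume (WithLp.toLp 2 ⁻¹' S) := fun S =>
    ((PiLp.volume_preserving_toLp (Fin (n + 1))).measure_preimage_equiv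
      (f := MeasurableEquiv.toLp 2 (Fin (n + 1) → ℝ)) S).symm
  have hbox : (WithLp.toLp 2 ⁻¹' {x : EuclideanSpace ℝ (Fin (n + 1)) | ∀ i, x i ∈ I i}) =
      Set.univ.pi I := by
    ext x; simp
  have hF : ContinuousOn (fun x : Fin (n + 1) → ℝ => f (WithLp.toLp 2 x)) (Set.univ.pi I) :=
    hf.comp (PiLp.continuous_toLp 2 _).continuousOn fun x hx i => hx i trivial
  have h := volume_pos_mul_volume_nonpos_le hI hs hF
  -- Passing from the Euclidean to the sup metric is 1-Lipschitz, so it does not increase Hausdorff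
  -- measure.
  have hH : Measure.hausdorffMeasure (n : ℝ)
      (Set.univ.pi I ∩ {x : Fin (n + 1) → ℝ | f (WithLp.toLp 2 x) = 0}) ≤
      Measure.hausdorffMeasure (n : ℝ) ({x | ∀ i, x i ∈ I i} ∩ {x | f x = 0}) := by
    have h1 := (PiLp.lipschitzWith_ofLp 2 (fun _ : Fin (n + 1) => ℝ)).hausdorffMeasure_image_le
      (d := (n : ℝ)) (by positivity) ({x | ∀ i, x i ∈ I i} ∩ {x | f x = 0})
    rw [ENNReal.coe_one, ENNReal.one_rpow, one_mul] at h1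
    refine (measure_mono fun x hx => ?_).trans h1
    exact ⟨WithLp.toLp 2 x, ⟨fun i => hx.1 i trivial, hx.2⟩, rfl⟩
  rw [hvol, hvol ({x | ∀ i, x i ∈ I i} ∩ {x | f x ≤ 0}), hvol {x | ∀ i, x i ∈ I i},
    Set.preimage_inter, Set.preimage_inter, hbox]
  exact h.trans (mul_le_mul_right hH _)

lemma measurableSet_unitCube (d : ℕ) : MeasurableSet (unitCube d) := by
  have : unitCube d = ⋂ i, {x | x i ∈ Set.Icc (0 : ℝ) 1} := by ext x; simp [unitCube]
  rw [this]
  exact MeasurableSet.iInter fun i =>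
    measurableSet_Icc.preimage (f := fun x : EuclideanSpace ℝ (Fin d) => x i) (by fun_prop)

lemma toLp_preimage_unitCube (d : ℕ) : WithLp.toLp 2 ⁻¹' unitCube d = Set.Icc (0 : Fin d → ℝ) 1 := by
  ext x
  simp [unitCube, Pi.le_def, forall_and]

lemma volume_unitCube (d : ℕ) : volume (unitCube d) = 1 := by
  rw [← (PiLp.volume_preserving_toLp (Fin d)).measure_preimage
    (measurableSet_unitCube d).nullMeasurableSet, toLp_preimage_unitCube, Real.volume_Icc_pi]
  simp

lemma posPartMeasure_apply_le {d : ℕ} {f : EuclideanSpace ℝ (Fin d) → ℝ} {M : ℝ≥0∞}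
    (hM : ∀ᵐ x ∂cubeVolume d, ‖f x‖ₑ ≤ M) {S : Set (EuclideanSpace ℝ (Fin d))}
    (hS : MeasurableSet S) :
    posPartMeasure f S ≤ M * volume (unitCube d ∩ S ∩ {x | 0 < f x}) := by
  rw [posPartMeasure, withDensity_apply _ hS, cubeVolume, Measure.restrict_restrict hS,
    Set.inter_comm S]
  rw [cubeVolume, ae_restrict_iff' (measurableSet_unitCube d)] at hM
  have hm := (measurableSet_unitCube d).inter hS
  rw [← lintegral_indicator hm]
  refine (lintegral_mono_ae ?_).trans (lintegral_indicator_const_le _ M)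
  filter_upwards [hM] with x hx
  by_cases h1 : x ∈ unitCube d ∩ S
  · by_cases h2 : 0 < f x
    · rw [Set.indicator_of_mem h1, Set.indicator_of_mem (show x ∈ _ ∩ _ from ⟨h1, h2⟩),
        max_eq_left h2.le, ← Real.enorm_of_nonneg h2.le]
      exact hx h1.1
    · rw [Set.indicator_of_mem h1, max_eq_right (not_lt.1 h2)]
      simp
  · rw [Set.indicator_of_notMem h1]
    exact zero_le

lemma posPartMeasure_le_of_forall_le {d : ℕ} {f : EuclideanSpace ℝ (Fin d) → ℝ} {η : ℝ}
    (hη : 0 ≤ η) {S : Set (EuclideanSpace ℝ (Fin d))} (hS : MeasurableSet S)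
    (h : ∀ x ∈ unitCube d, x ∈ S → f x ≤ η) :
    posPartMeasure f S ≤ ENNReal.ofReal η * cubeVolume d S := by
  rw [posPartMeasure, withDensity_apply _ hS, cubeVolume, Measure.restrict_restrict hS,
    Measure.restrict_apply hS, ← setLIntegral_const]
  exact setLIntegral_mono measurable_const fun x hx =>
    ENNReal.ofReal_le_ofReal (max_le (h x hx.2 hx.1) hη)

lemma posPartMeasure_univ {d : ℕ} (f : EuclideanSpace ℝ (Fin d) → ℝ) :
    posPartMeasure f Set.univ = posPartMeasure f (unitCube d) := by
  refine le_antisymm ?_ (measure_mono (Set.subset_univ _))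
  have hc : posPartMeasure f (unitCube d)ᶜ = 0 := by
    refine withDensity_absolutelyContinuous _ _ ?_
    rw [cubeVolume, Measure.restrict_apply (measurableSet_unitCube d).compl]
    simp
  rw [← Set.union_compl_self (unitCube d)]
  simpa [hc] using measure_union_le (μ := posPartMeasure f) (unitCube d) (unitCube d)ᶜ

/-- One of `{f ≤ 0}`, `{f ≥ 0}` fills at least half of the box; dividing the isoperimetric
inequality by that volume bounds the volume where `f` has the opposite strict sign. -/
lemma min_measure_box_le {n : ℕ} {I : Fin (n + 1) → Set ℝ}
    (hI : ∀ i, (I i).OrdConnected) {s : ℝ≥0∞} (hs : ∀ i, volume (I i) ≤ s)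
    {f : EuclideanSpace ℝ (Fin (n + 1)) → ℝ} (hf : ContinuousOn f (unitCube (n + 1))) {M : ℝ≥0∞}
    (hM : ∀ᵐ x ∂cubeVolume (n + 1), ‖f x‖ₑ ≤ M) :
    min (posPartMeasure f {x | ∀ i, x i ∈ I i}) (negPartMeasure f {x | ∀ i, x i ∈ I i}) ≤
      2 * ((n : ℝ≥0∞) + 1) * M * s *
        Measure.hausdorffMeasure (n : ℝ) ({x | ∀ i, x i ∈ I i} ∩ nodalSet f) := by
  set Q : Set (EuclideanSpace ℝ (Fin (n + 1))) := {x | ∀ i, x i ∈ I i} with hQ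
  set H := Measure.hausdorffMeasure (n : ℝ) (Q ∩ nodalSet f) with hH
  have hQm : MeasurableSet Q := by
    have : Q = ⋂ i, {x | x i ∈ I i} := by ext x; simp [hQ]
    rw [this]
    exact MeasurableSet.iInter fun i =>
      (hI i).measurableSet.preimage (f := fun x : EuclideanSpace ℝ (Fin (n + 1)) => x i)
        (by fun_prop)
  have hcap : {x : EuclideanSpace ℝ (Fin (n + 1)) | ∀ i, x i ∈ I i ∩ Set.Icc 0 1} =
      unitCube (n + 1) ∩ Q := by
    ext x; simp only [hQ, unitCube, Set.mem_inter_iff, Set.mem_ofPred_eq]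
    exact ⟨fun h => ⟨fun i => (h i).2, fun i => (h i).1⟩, fun h i => ⟨h.2 i, h.1 i⟩⟩
  set V := volume (unitCube (n + 1) ∩ Q) with hV
  have hVtop : V ≠ ∞ := ((measure_mono Set.inter_subset_left).trans_lt
    (by rw [volume_unitCube]; exact ENNReal.one_lt_top)).ne
  have key : ∀ g : EuclideanSpace ℝ (Fin (n + 1)) → ℝ, ContinuousOn g (unitCube (n + 1)) →
      (∀ᵐ x ∂cubeVolume (n + 1), ‖g x‖ₑ ≤ M) → (nodalSet g = nodalSet f) →
      V / 2 ≤ volume (unitCube (n + 1) ∩ Q ∩ {x | g x ≤ 0}) →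
      posPartMeasure g Q ≤ 2 * ((n : ℝ≥0∞) + 1) * M * s * H := by
    intro g hg hgM hgZ hhalf
    refine (posPartMeasure_apply_le hgM hQm).trans ?_
    have h := volume_box_pos_mul_volume_box_nonpos_le (I := fun i => I i ∩ Set.Icc 0 1)
      (fun i => (hI i).inter Set.ordConnected_Icc)
      (fun i => (measure_mono Set.inter_subset_left).trans (hs i))
      (f := g) (hg.mono (by rw [hcap]; exact Set.inter_subset_left))
    rw [hcap] at h
    have hz : unitCube (n + 1) ∩ Q ∩ {x | g x = 0} = Q ∩ nodalSet f := by
      rw [← hgZ]; ext x; simp only [nodalSet, Set.mem_inter_iff, Set.mem_ofPred_eq]; tauto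
    rw [hz, ← hH, ← hV] at h
    set A := volume (unitCube (n + 1) ∩ Q ∩ {x | 0 < g x}) with hA
    have hAV : A ≤ V := measure_mono Set.inter_subset_left
    have hA2 : A ≤ 2 * ((n : ℝ≥0∞) + 1) * s * H := by
      by_cases hV0 : V = 0
      · rw [hV0] at hAV; exact hAV.trans (zero_le)
      · have h2 : V * A ≤ V * (2 * ((n : ℝ≥0∞) + 1) * s * H) := by
          calc V * A = 2 * (A * (V / 2)) := by
                rw [mul_left_comm, ENNReal.mul_div_cancel (by simp) (by simp), mul_comm]
            _ ≤ 2 * (((n : ℝ≥0∞) + 1) * s * V * H) :=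
                mul_le_mul_right ((mul_le_mul_right hhalf A).trans h) 2
            _ = V * (2 * ((n : ℝ≥0∞) + 1) * s * H) := by ring
        exact (ENNReal.mul_le_mul_iff_right hV0 hVtop).1 h2
    calc M * A ≤ M * (2 * ((n : ℝ≥0∞) + 1) * s * H) := by gcongr
      _ = _ := by ring
  by_cases hhalf : V / 2 ≤ volume (unitCube (n + 1) ∩ Q ∩ {x | f x ≤ 0})
  · exact (min_le_left _ _).trans (key f hf hM rfl hhalf)
  · refine (min_le_right _ _).trans (key (fun x => -f x) hf.neg (by simpa using hM)
      (by ext x; simp [nodalSet]) ?_)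
    have hsplit : V ≤ volume (unitCube (n + 1) ∩ Q ∩ {x | f x ≤ 0}) +
        volume (unitCube (n + 1) ∩ Q ∩ {x | -f x ≤ 0}) := by
      refine (measure_mono fun x hx => ?_).trans (measure_union_le _ _)
      rcases le_total (f x) 0 with h | h
      · exact Or.inl ⟨hx, h⟩
      · exact Or.inr ⟨hx, by simpa using h⟩
    by_contra hcon
    have := ENNReal.add_lt_add (not_le.1 hhalf) (not_le.1 hcon)
    rw [ENNReal.add_halves] at this
    exact absurd hsplit (not_le.2 this)

/-! ### Global estimates on the cube -/

section Cube

variable {n : ℕ} {f : EuclideanSpace ℝ (Fin (n + 1)) → ℝ}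

lemma min_measure_univ_le (hf : ContinuousOn f (unitCube (n + 1))) {M : ℝ≥0∞}
    (hM : ∀ᵐ x ∂cubeVolume (n + 1), ‖f x‖ₑ ≤ M) :
    min (posPartMeasure f Set.univ) (negPartMeasure f Set.univ) ≤
      2 * ((n : ℝ≥0∞) + 1) * M * Measure.hausdorffMeasure (n : ℝ) (nodalSet f) := by
  have h := min_measure_box_le (I := fun _ => Set.Icc (0 : ℝ) 1) (s := 1)
    (fun _ => Set.ordConnected_Icc) (fun _ => by simp) hf hM
  rw [posPartMeasure_univ, show negPartMeasure f Set.univ = negPartMeasure f (unitCube (n + 1))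
    from posPartMeasure_univ fun x => -f x]
  rw [mul_one] at h
  exact h.trans (mul_le_mul_right (measure_mono Set.inter_subset_right) _)

lemma posPartMeasure_univ_le_of_hausdorff (hf : ContinuousOn f (unitCube (n + 1))) {M : ℝ≥0∞}
    (hM : ∀ᵐ x ∂cubeVolume (n + 1), ‖f x‖ₑ ≤ M) [IsFiniteMeasure (posPartMeasure f)]
    {ρ : Measure (EuclideanSpace ℝ (Fin (n + 1)) × EuclideanSpace ℝ (Fin (n + 1)))}
    (h : IsCoupling ρ (posPartMeasure f) (negPartMeasure f)) {N : ℝ} (hN : 0 < N) :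
    posPartMeasure f Set.univ ≤
      2 * ((n : ℝ≥0∞) + 1) * M * ENNReal.ofReal N⁻¹ *
        Measure.hausdorffMeasure (n : ℝ) (nodalSet f) +
      ((n : ℝ≥0∞) + 1) * ENNReal.ofReal N * ∫⁻ p, edist p.1 p.2 ∂ρ := by
  have hκ := h.measure_univ_le_of_grid hN
    (κ := (2 * ((n : ℝ≥0∞) + 1) * M * ENNReal.ofReal N⁻¹) •
      (Measure.hausdorffMeasure (n : ℝ)).restrict (nodalSet f)) (fun τ k => by
      have hset : gridIndex N τ ⁻¹' {k} = {x : EuclideanSpace ℝ (Fin (n + 1)) |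
          ∀ i, x i ∈ {t : ℝ | ⌊N * t + τ⌋ = k i}} := by
        ext x; simp [gridIndex, funext_iff]
      rw [Measure.smul_apply, Measure.restrict_apply (measurableSet_gridIndex_preimage N τ k),
        hset, smul_eq_mul]
      exact min_measure_box_le (fun i => ordConnected_floor_preimage hN τ (k i))
        (fun i => volume_floor_preimage_le hN τ (k i)) hf hM)
  simpa using hκ

/-- By uniform continuity `f` oscillates by less than `η` on fine cells, so a cell containing a
negative value has `f < η` throughout. -/
lemma exists_mesh_min_measure_le (hf : ContinuousOn f (unitCube (n + 1))) {η : ℝ} (hη : 0 < η) :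
    ∃ N : ℝ, 0 < N ∧ ∀ τ k,
      min (posPartMeasure f (gridIndex N τ ⁻¹' {k})) (negPartMeasure f (gridIndex N τ ⁻¹' {k})) ≤
        ENNReal.ofReal η * cubeVolume (n + 1) (gridIndex N τ ⁻¹' {k}) := by
  have hF : ContinuousOn (fun x : Fin (n + 1) → ℝ => f (WithLp.toLp 2 x)) (Set.Icc 0 1) := by
    rw [← toLp_preimage_unitCube]
    exact hf.comp (PiLp.continuous_toLp 2 _).continuousOn fun x hx => hx
  obtain ⟨δ, hδ, h⟩ := Metric.uniformContinuousOn_iff.1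
    (isCompact_Icc.uniformContinuousOn_of_continuous hF) η hη
  have hosc : ∀ τ, ∀ x ∈ unitCube (n + 1), ∀ y ∈ unitCube (n + 1),
      gridIndex δ⁻¹ τ x = gridIndex δ⁻¹ τ y → f x < f y + η := by
    intro τ x hx y hy hxy
    have hd := h x.ofLp (by rw [← toLp_preimage_unitCube]; exact hx) y.ofLp
      (by rw [← toLp_preimage_unitCube]; exact hy) (by
        refine (dist_pi_lt_iff hδ).2 fun i => ?_
        have hi := Int.abs_sub_lt_one_of_floor_eq_floor (congr_fun hxy i)
        rw [add_sub_add_right_eq_sub, ← mul_sub, abs_mul, abs_of_pos (inv_pos.2 hδ),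
          inv_mul_lt_iff₀ hδ, mul_one] at hi
        exact hi)
    have := (abs_lt.1 hd).2
    simp only [WithLp.toLp_ofLp] at this
    linarith
  refine ⟨δ⁻¹, inv_pos.2 hδ, fun τ k => ?_⟩
  have hQ := measurableSet_gridIndex_preimage (d := n + 1) δ⁻¹ τ k
  by_cases hneg : ∃ y ∈ unitCube (n + 1), y ∈ gridIndex δ⁻¹ τ ⁻¹' {k} ∧ f y < 0
  · obtain ⟨y, hy, hyQ, hfy⟩ := hneg
    refine (min_le_left _ _).trans (posPartMeasure_le_of_forall_le hη.le hQ fun x hx hxQ => ?_)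
    have := hosc τ x hx y hy (hxQ.trans hyQ.symm)
    linarith
  · push Not at hneg
    refine (min_le_right _ _).trans
      ((posPartMeasure_le_of_forall_le (f := fun x => -f x) le_rfl hQ fun x hx hxQ => ?_).trans ?_)
    · linarith [hneg x hx hxQ]
    · simp

/-- On a fine enough grid at most half of the mass stays in its cell, so the rest must cross at
definite average cost. This excludes the product `∞ * 0` when the nodal set has infinite measure. -/
lemma vasersteinDist_posPart_negPart_ne_zero (hf : ContinuousOn f (unitCube (n + 1)))
    [IsFiniteMeasure (posPartMeasure f)] (h0 : posPartMeasure f Set.univ ≠ 0) :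
    vasersteinDist (posPartMeasure f) (negPartMeasure f) ≠ 0 := by
  set p := posPartMeasure f Set.univ with hp
  have hptop : p ≠ ∞ := measure_ne_top _ _
  obtain ⟨N, hN, hκ⟩ := exists_mesh_min_measure_le hf (η := p.toReal / 2)
    (by have := ENNReal.toReal_pos h0 hptop; positivity)
  have hη : ENNReal.ofReal (p.toReal / 2) = p / 2 := by
    rw [ENNReal.ofReal_div_of_pos two_pos, ENNReal.ofReal_toReal hptop]; simp
  set K : ℝ≥0∞ := ((n + 1 : ℕ) : ℝ≥0∞) * ENNReal.ofReal N with hK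
  have hle : p / 2 / K ≤ vasersteinDist (posPartMeasure f) (negPartMeasure f) := by
    refine le_iInf₂ fun ρ h => ENNReal.div_le_of_le_mul ?_
    have h1 := h.measure_univ_le_of_grid hN (κ := ENNReal.ofReal (p.toReal / 2) • cubeVolume (n + 1))
      (fun τ k => by rw [Measure.smul_apply, smul_eq_mul]; exact hκ τ k)
    rw [← hp, Measure.smul_apply, cubeVolume, Measure.restrict_apply_univ, volume_unitCube,
      smul_eq_mul, mul_one, hη, ← hK] at h1
    have h2 : p / 2 + p / 2 ≤ p / 2 + K * ∫⁻ q, edist q.1 q.2 ∂ρ := by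
      rwa [ENNReal.add_halves]
    rw [mul_comm]
    exact (ENNReal.add_le_add_iff_left (ENNReal.div_ne_top hptop (by simp))).1 h2
  refine (lt_of_lt_of_le (ENNReal.div_pos ?_ ?_) hle).ne'
  · simpa using h0
  · rw [hK]; finiteness

lemma sq_posPartMeasure_le (hf : ContinuousOn f (unitCube (n + 1))) {M : ℝ≥0∞}
    (hM : ∀ᵐ x ∂cubeVolume (n + 1), ‖f x‖ₑ ≤ M) (hMtop : M ≠ ∞)
    (heq : posPartMeasure f Set.univ = negPartMeasure f Set.univ) :
    posPartMeasure f Set.univ ^ 2 ≤ 8 * ((n : ℝ≥0∞) + 1) ^ 2 * M *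
      Measure.hausdorffMeasure (n : ℝ) (nodalSet f) *
      vasersteinDist (posPartMeasure f) (negPartMeasure f) := by
  set p := posPartMeasure f Set.univ with hp
  set H := Measure.hausdorffMeasure (n : ℝ) (nodalSet f) with hH
  by_cases hp0 : p = 0
  · simp [hp0]
  have hpM : p ≤ M := by
    refine (posPartMeasure_apply_le hM MeasurableSet.univ).trans ?_
    calc M * volume (unitCube (n + 1) ∩ Set.univ ∩ {x | 0 < f x})
        ≤ M * volume (unitCube (n + 1)) := by
          gcongr; exact fun x hx => hx.1.1
      _ = M := by rw [volume_unitCube, mul_one]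
  have hptop : p ≠ ∞ := ne_top_of_le_ne_top hMtop hpM
  have : IsFiniteMeasure (posPartMeasure f) := ⟨hptop.lt_top⟩
  have hM0 : M ≠ 0 := fun h => hp0 (le_antisymm (h ▸ hpM) zero_le)
  have hW := vasersteinDist_posPart_negPart_ne_zero hf hp0
  have hH0 : H ≠ 0 := by
    intro h
    have := min_measure_univ_le hf hM
    rw [← heq, min_self, ← hp, ← hH, h, mul_zero] at this
    exact hp0 (le_antisymm this zero_le)
  by_cases hHtop : H = ∞
  · rw [hHtop, ENNReal.mul_top (by simp [hM0]), ENNReal.top_mul hW]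
    exact le_top
  set a : ℝ≥0∞ := 2 * ((n : ℝ≥0∞) + 1) * M * H with ha
  have ha0 : a ≠ 0 := by simp [ha, hM0, hH0]
  have hatop : a ≠ ∞ := by finiteness
  have hp' := ENNReal.toReal_pos hp0 hptop
  have ha' := ENNReal.toReal_pos ha0 hatop
  -- This mesh makes the nodal term exactly `p / 2`, leaving `p / 2` for the transport term.
  set N : ℝ := 2 * a.toReal / p.toReal with hN
  have hNpos : 0 < N := by positivity
  have hN1 : ENNReal.ofReal N = 2 * a / p := by
    rw [hN, ENNReal.ofReal_div_of_pos hp', ENNReal.ofReal_mul two_pos.le,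
      ENNReal.ofReal_toReal hatop, ENNReal.ofReal_toReal hptop]
    simp
  have hN2 : a * ENNReal.ofReal N⁻¹ = p / 2 := by
    rw [hN, inv_div, ENNReal.ofReal_div_of_pos (by positivity), ENNReal.ofReal_mul two_pos.le,
      ENNReal.ofReal_toReal hatop, ENNReal.ofReal_toReal hptop, ENNReal.ofReal_ofNat,
      ← mul_div_assoc, mul_comm 2 a, ENNReal.mul_div_mul_left _ _ ha0 hatop]
  have hcoef : 8 * ((n : ℝ≥0∞) + 1) ^ 2 * M * H = 4 * ((n : ℝ≥0∞) + 1) * a := by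
    rw [ha]; ring
  rw [hcoef, vasersteinDist, ENNReal.mul_iInf_of_ne (by simp [ha0]) (by finiteness)]
  refine le_iInf fun ρ => ?_
  rw [ENNReal.mul_iInf_of_ne (by simp [ha0]) (by finiteness)]
  refine le_iInf fun h => ?_
  set C := ∫⁻ q, edist q.1 q.2 ∂ρ
  have h1 := posPartMeasure_univ_le_of_hausdorff hf hM h hNpos
  rw [← hp, ← hH, mul_right_comm, ← ha, hN2, hN1] at h1
  have h2 : p / 2 + p / 2 ≤ p / 2 + ((n : ℝ≥0∞) + 1) * (2 * a / p) * C := by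
    rwa [ENNReal.add_halves]
  have h3 := (ENNReal.add_le_add_iff_left (ENNReal.div_ne_top hptop (by simp))).1 h2
  calc p ^ 2 = 2 * p * (p / 2) := by
        rw [mul_comm 2 p, mul_assoc, ENNReal.mul_div_cancel (by simp) (by simp), sq]
    _ ≤ 2 * p * (((n : ℝ≥0∞) + 1) * (2 * a / p) * C) := mul_le_mul_right h3 _
    _ = 2 * ((n : ℝ≥0∞) + 1) * (p * (2 * a / p)) * C := by ring
    _ = 4 * ((n : ℝ≥0∞) + 1) * a * C := by
        rw [ENNReal.mul_div_cancel hp0 hptop]; ring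

end Cube

/-! ### Zero mean, norms and conclusion -/

lemma posPartMeasure_univ_eq_negPartMeasure_univ {d : ℕ} {f : EuclideanSpace ℝ (Fin d) → ℝ}
    (hf : Integrable f (cubeVolume d)) (h0 : ∫ x, f x ∂(cubeVolume d) = 0) :
    posPartMeasure f Set.univ = negPartMeasure f Set.univ := by
  have hpos : ∀ x : ℝ, ENNReal.ofReal (max x 0) = ENNReal.ofReal x := fun x => by
    rcases le_total x 0 with h | h
    · simp [h]
    · rw [max_eq_left h]
  simp only [posPartMeasure, negPartMeasure, withDensity_apply _ MeasurableSet.univ,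
    Measure.restrict_univ, hpos]
  rw [integral_eq_lintegral_pos_part_sub_lintegral_neg_part hf, sub_eq_zero] at h0
  exact (ENNReal.toReal_eq_toReal_iff' hf.lintegral_lt_top.ne
    hf.neg.lintegral_lt_top.ne).1 h0

lemma eLpNorm_one_le_posPartMeasure_add_negPartMeasure {d : ℕ}
    {f : EuclideanSpace ℝ (Fin d) → ℝ} (hf : AEMeasurable f (cubeVolume d)) :
    eLpNorm f 1 (cubeVolume d) ≤ posPartMeasure f Set.univ + negPartMeasure f Set.univ := by
  rw [eLpNorm_one_eq_lintegral_enorm, posPartMeasure, negPartMeasure,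
    withDensity_apply _ MeasurableSet.univ, withDensity_apply _ MeasurableSet.univ,
    Measure.restrict_univ, ← lintegral_add_left' (by fun_prop)]
  refine lintegral_mono fun x => ?_
  rw [← ENNReal.ofReal_add (le_max_right _ _) (le_max_right _ _), ← ofReal_norm]
  exact ENNReal.ofReal_le_ofReal (abs_le.2 ⟨by
    linarith [le_max_left (-f x) 0, le_max_right (f x) 0], by
    linarith [le_max_left (f x) 0, le_max_right (-f x) 0]⟩)

theorem theorem1 (d : ℕ) (hd : 1 ≤ d) :
    ∃ c : ℝ≥0, 0 < c ∧ ∀ f : EuclideanSpace ℝ (Fin d) → ℝ,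
      ContinuousOn f (unitCube d) → ∫ x, f x ∂(cubeVolume d) = 0 →
        (c : ℝ≥0∞) * eLpNorm f 1 (cubeVolume d) ≤
          vasersteinDist (posPartMeasure f) (negPartMeasure f) *
            Measure.hausdorffMeasure ((d : ℝ) - 1) (nodalSet f) *
            (eLpNorm f ∞ (cubeVolume d) / eLpNorm f 1 (cubeVolume d)) ^ (2 - 1 / (d : ℝ)) := by
  obtain ⟨n, rfl⟩ : ∃ n, d = n + 1 := ⟨d - 1, by omega⟩
  -- The factor 32 is the 8 of `sq_posPartMeasure_le` times 4, from squaring `‖f‖₁ ≤ 2p`.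
  refine ⟨(32 * ((n : ℝ≥0) + 1) ^ 2)⁻¹, by positivity, fun f hf hmean => ?_⟩
  have hexp : ((n + 1 : ℕ) : ℝ) - 1 = n := by push_cast; ring
  rw [hexp]
  have hcompact : IsCompact (unitCube (n + 1)) := by
    have : unitCube (n + 1) = WithLp.toLp 2 '' Set.Icc (0 : Fin (n + 1) → ℝ) 1 := by
      rw [← toLp_preimage_unitCube, Set.image_preimage_eq _ (WithLp.toLp_surjective 2)]
    rw [this]
    exact isCompact_Icc.image (PiLp.continuous_toLp 2 _)
  have hprob : IsProbabilityMeasure (cubeVolume (n + 1)) :=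
    ⟨by rw [cubeVolume, Measure.restrict_apply_univ, volume_unitCube]⟩
  have hint : Integrable f (cubeVolume (n + 1)) := hf.integrableOn_compact hcompact
  have hM : ∀ᵐ x ∂cubeVolume (n + 1), ‖f x‖ₑ ≤ eLpNorm f ∞ (cubeVolume (n + 1)) := by
    rw [eLpNorm_exponent_top]; exact ae_le_eLpNormEssSup
  have hMtop : eLpNorm f ∞ (cubeVolume (n + 1)) ≠ ∞ := by
    obtain ⟨B, hB⟩ := hcompact.exists_bound_of_continuousOn hf
    rw [eLpNorm_exponent_top]
    exact (eLpNormEssSup_lt_top_of_ae_bound (C := B)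
      ((ae_restrict_iff' (measurableSet_unitCube _)).2 (Filter.Eventually.of_forall hB))).ne
  have heq := posPartMeasure_univ_eq_negPartMeasure_univ hint hmean
  have hsq := sq_posPartMeasure_le hf hM hMtop heq
  have hm1 := eLpNorm_one_le_posPartMeasure_add_negPartMeasure hint.aemeasurable
  rw [← heq, ← two_mul] at hm1
  have hm2 : eLpNorm f 1 (cubeVolume (n + 1)) ≤ eLpNorm f ∞ (cubeVolume (n + 1)) :=
    eLpNorm_le_eLpNorm_of_exponent_le le_top hint.aestronglyMeasurable
  set m := eLpNorm f 1 (cubeVolume (n + 1))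
  set M := eLpNorm f ∞ (cubeVolume (n + 1))
  set H := Measure.hausdorffMeasure (n : ℝ) (nodalSet f)
  set W := vasersteinDist (posPartMeasure f) (negPartMeasure f)
  by_cases hm0 : m = 0
  · simp [hm0]
  have hmtop : m ≠ ∞ := ne_top_of_le_ne_top hMtop hm2
  have hone : 1 ≤ M / m := (ENNReal.le_div_iff_mul_le (Or.inl hm0) (Or.inl hmtop)).2 (by simpa)
  have hrpow : M / m ≤ (M / m) ^ (2 - 1 / ((n + 1 : ℕ) : ℝ)) := by
    conv_lhs => rw [← ENNReal.rpow_one (M / m)]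
    refine ENNReal.rpow_le_rpow_of_exponent_le hone ?_
    have : 1 / ((n + 1 : ℕ) : ℝ) ≤ 1 := by
      rw [div_le_one (by positivity)]; push_cast; linarith [(Nat.cast_nonneg n : (0 : ℝ) ≤ n)]
    linarith
  have hmain : m ^ 2 ≤ 32 * ((n : ℝ≥0∞) + 1) ^ 2 * (W * H * M) := by
    calc m ^ 2 ≤ (2 * posPartMeasure f Set.univ) ^ 2 := by gcongr
      _ = 4 * posPartMeasure f Set.univ ^ 2 := by ring
      _ ≤ 4 * (8 * ((n : ℝ≥0∞) + 1) ^ 2 * M * H * W) := by gcongr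
      _ = 32 * ((n : ℝ≥0∞) + 1) ^ 2 * (W * H * M) := by ring
  have hK0 : (32 * ((n : ℝ≥0) + 1) ^ 2) ≠ 0 := by positivity
  rw [ENNReal.coe_inv hK0]
  push_cast
  rw [mul_comm _ m, ← div_eq_mul_inv]
  refine ENNReal.div_le_of_le_mul ?_
  calc m = m ^ 2 / m := by
        rw [sq, ENNReal.mul_div_cancel_right hm0 hmtop]
    _ ≤ 32 * ((n : ℝ≥0∞) + 1) ^ 2 * (W * H * M) / m := by gcongr
    _ = W * H * (M / m) * (32 * ((n : ℝ≥0∞) + 1) ^ 2) := by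
        simp only [div_eq_mul_inv]; ring
    _ ≤ _ := by gcongr; exact_mod_cast hrpow
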